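/- Let $\mathbb D=\{z\in\mathbb C:|z|<1\}$. A non-empty set $\mathfrak M$ of functions $h(z)=z+a_2(h)z^2+\cdots$, analytic in $\mathbb D$ with $h'\neq 0$ in $\mathbb D$, is a linear invariant family if for every $h\in\mathfrak M$ and every automorphism $\phi(z)=e^{i\theta}\frac{z+a}{1+\bar a z}$ of $\mathbb D$ ($|a|<1$, $\theta\in\mathbb R$) the function $\frac{h(\phi(z))-h(\phi(0))}{h'(\phi(0))\phi'(0)}$ belongs to $\mathfrak M$; its order is $\sup_{h\in\mathfrak M}|a_2(h)|$. Let $\mathcal U_\alpha$ be the union of all linear invariant families of order at most $\alpha$. For $\alpha\in[0,\infty]$, $1\le Q<\infty$ and $k=(Q-1)/(Q+1)$, let $\mathcal H(\alpha,Q)$ be the set of all locally univalent harmonic mappings $f=h+\overline g$ in $\mathbb D$, with $h,g$ analytic in $\mathbb D$ and $h(0)=g(0)=0$, such that $h'(0)+\overline{g'(0)}=1$, $h/h'(0)\in\mathcal U_\alpha$ and $|g'(z)/h'(z)|\le k$ for all $z\in\mathbb D$. For $F:\mathbb D\to\mathbb C$ and $a\in\mathbb D$, let $d_F(a)$ be the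 radius of the largest univalent disk centered at $F(a)$, i.e. the supremum of all $r>0$ such that $F$ maps some open subset of $\mathbb D$ containing $a$ bijectively onto $\{w:|w-F(a)|<r\}$. Then for every $f=h+\overline g\in\mathcal H(\alpha,Q)$, with $H=h/h'(0)\in\mathcal U_\alpha$, $$\frac{d_H(z)}{Q}\le d_f(z)\le Q\,d_H(z)\qquad\text{for all } z\in\mathbb D .$$ Both bounds are sharp at $z=0$: for every $\alpha\ge 1$ and every $Q\in[1,\infty)$ there is an $f\in\mathcal H(\alpha,Q)$ with $d_f(0)=d_H(0)/Q$, and there is an $f\in\mathcal H(\alpha,Q)$ with $d_f(0)=Q\,d_H(0)$ (where again $f=h+\overline g$ and $H=h/h'(0)$). -/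

import Mathlib

open Set
open scoped ENNReal ComplexConjugate Topology

/-- The open unit disk. Functions on the disk are represented by functions `ℂ → ℂ`; only their
values on the disk matter below. -/
def unitDisk : Set ℂ := Metric.ball 0 1

/-- The conformal automorphism `z ↦ e^{iθ} (z + a) / (1 + ā z)` of the unit disk (for `|a| < 1`). -/
noncomputable def diskAut (a : ℂ) (θ : ℝ) (z : ℂ) : ℂ :=
  Complex.exp (θ * Complex.I) * ((z + a) / (1 + conj a * z))

/-- The transform `H_φ(z) = (h(φ(z)) - h(φ(0))) / (h'(φ(0)) φ'(0))`. -/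
noncomputable def linTransform (h φ : ℂ → ℂ) (z : ℂ) : ℂ :=
  (h (φ z) - h (φ 0)) / (deriv h (φ 0) * deriv φ 0)

/-- Linear invariant families of analytic, locally univalent functions `h(z) = z + a₂ z² + ⋯`
in the unit disk. Functions are identified when they agree on the disk. -/
structure IsLIF (M : Set (ℂ → ℂ)) : Prop where
  nonempty : M.Nonempty
  analytic : ∀ h ∈ M, DifferentiableOn ℂ h unitDisk
  locallyUnivalent : ∀ h ∈ M, ∀ z ∈ unitDisk, deriv h z ≠ 0
  map_zero : ∀ h ∈ M, h 0 = 0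
  deriv_zero : ∀ h ∈ M, deriv h 0 = 1
  invariant : ∀ h ∈ M, ∀ (a : ℂ) (θ : ℝ), ‖a‖ < 1 →
    ∃ H ∈ M, EqOn H (linTransform h (diskAut a θ)) unitDisk

/-- The order `sup_{h ∈ M} |a₂(h)|`, with `a₂(h) = h''(0) / 2`. -/
noncomputable def lifOrder (M : Set (ℂ → ℂ)) : ℝ≥0∞ :=
  ⨆ h ∈ M, ‖iteratedDeriv 2 h 0 / 2‖ₑ

/-- The universal linear invariant family `𝒰_α`: all functions that belong to some linear
invariant family of order at most `α`. -/
def universalLIF (α : ℝ≥0∞) : Set (ℂ → ℂ) :=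
  {h | ∃ M : Set (ℂ → ℂ), IsLIF M ∧ lifOrder M ≤ α ∧ h ∈ M}

/-- The function `H(z) = h(z) / h'(0)`. -/
noncomputable def normalizedPart (h : ℂ → ℂ) (z : ℂ) : ℂ := h z / deriv h 0

/-- `f ∈ ℋ(α, Q)`, where `f = h + ḡ` is its decomposition into the analytic part `h` and the
co-analytic part `g`, both vanishing at `0`. The coefficients of `z` and `z̄` in the expansion of
`f` are `a₁ = h'(0)` and `a₋₁ = conj (g'(0))`. Note that `h' ≠ 0` in the disk, as
`h / h'(0) ∈ 𝒰_α`, and that a locally univalent harmonic map is (locally) `Q`-quasiconformal when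
its dilatation `g' / h'` is at most `k = (Q - 1) / (Q + 1)` in modulus. -/
structure MemHarmonicFamily (α : ℝ≥0∞) (Q : ℝ) (f h g : ℂ → ℂ) : Prop where
  analytic_h : DifferentiableOn ℂ h unitDisk
  analytic_g : DifferentiableOn ℂ g unitDisk
  h_zero : h 0 = 0
  g_zero : g 0 = 0
  decomposition : ∀ z ∈ unitDisk, f z = h z + conj (g z)
  locallyUnivalent : ∀ z ∈ unitDisk, ∃ U ∈ 𝓝 z, InjOn f U
  normalization : deriv h 0 + conj (deriv g 0) = 1
  normalizedPart_mem : normalizedPart h ∈ universalLIF α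
  dilatation_le : ∀ z ∈ unitDisk, ‖deriv g z / deriv h z‖ ≤ (Q - 1) / (Q + 1)

/-- `d_f(a)`: the radius of the largest univalent disk centered at `f(a)`, that is, the supremum of
all `r > 0` such that `f` maps some open subset of the unit disk containing `a` univalently onto
the disk of radius `r` centered at `f(a)`. -/
noncomputable def univalentRadius (f : ℂ → ℂ) (a : ℂ) : ℝ≥0∞ :=
  ⨆ (r : ℝ) (_ : 0 < r ∧ ∃ U : Set ℂ, IsOpen U ∧ U ⊆ unitDisk ∧ a ∈ U ∧
    BijOn f U (Metric.ball (f a) r)), ENNReal.ofReal r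

/-!
The two estimates are instances of one comparison principle,
`IsUnivalentRadius.div_of_norm_le`: if `p` and `q` are local diffeomorphisms of the same open set
with `‖Dq v‖ ≤ L ‖Dp v‖`, and `q` has a univalent disk of radius `R` around its value at `a`, then
`p` has one of radius `R / L` around its value at `a`. Let `ρ` be the largest univalent radius of
`p` at `a`, let `V` be the corresponding neighborhood of `a`, and suppose that `ρ < R / L`. On `V`
the map `q` is `L`-Lipschitz with respect to `p`, because `p` maps `V` onto a ball, which is convex.
So `q` maps `V` into the closed ball of radius `L ρ < R`, and uniqueness of lifts places `V` in the
image of this closed ball under the inverse of `q`, a compact set. On the closure of `V` the Lipschitz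
estimate persists, so `p` inherits injectivity from `q`. A map that is injective on a compact set
and locally injective near it is injective on a neighborhood of it, so the inverse of `p` extends to
a ball of radius greater than `ρ`, a contradiction.

For `f = h + conj g` with dilatation at most `k = (Q - 1) / (Q + 1)`, the derivative of `f` satisfies
`(1 - k) |h' v| ≤ |Df v| ≤ (1 + k) |h' v|`, and the normalization `h'(0) + conj (g'(0)) = 1` gives
`1 / (1 + k) ≤ |h'(0)| ≤ 1 / (1 - k)`. Since `(1 + k) / (1 - k) = Q`, the derivatives of `f` and of
`H = h / h'(0)` dominate each other with the factor `Q`, and the principle applies in both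
directions (`univalentRadius_bounds`).

For sharpness, the maps `z / (1 - c z)` with `|c| = 1` form a linear invariant family of order `1`
(`isLIF_halfPlaneMap`). For `c = -i` the image is the half-plane `Im w > -1/2`, and stretching the
imaginary direction by `s = Q` or `s = 1 / Q` gives the harmonic mapping `Re H + i s Im H` onto the
half-plane `Im w > -s/2`; it has the admissible dilatation `(1 - s) / (1 + s)`.
-/

/-! ### Univalent disks of local diffeomorphisms -/

/-- `F` maps some open subset of `D` containing `a` bijectively onto the ball of radius `r > 0`
centered at `F a`. -/
def IsUnivalentRadius {X E : Type*} [TopologicalSpace X] [PseudoMetricSpace E] (D : Set X)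
    (F : X → E) (a : X) (r : ℝ) : Prop :=
  0 < r ∧ ∃ U : Set X, IsOpen U ∧ U ⊆ D ∧ a ∈ U ∧ BijOn F U (Metric.ball (F a) r)

/-- Two continuous lifts through a map that is locally injective on `D` agree on a preconnected set
as soon as they agree at one point. -/
theorem eqOn_of_comp_eqOn_of_locallyInjOn {A X E : Type*} [TopologicalSpace A] [TopologicalSpace X]
    [T2Space X] {D : Set X} {p : X → E} {B : Set A} {ψ₁ ψ₂ : A → X}
    (inj : ∀ x ∈ D, ∃ u ∈ 𝓝 x, InjOn p u) (hB : IsPreconnected B)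
    (c₁ : ContinuousOn ψ₁ B) (c₂ : ContinuousOn ψ₂ B) (m₁ : MapsTo ψ₁ B D) (m₂ : MapsTo ψ₂ B D)
    (he : ∀ w ∈ B, p (ψ₁ w) = p (ψ₂ w)) {b : A} (hb : b ∈ B) (hbe : ψ₁ b = ψ₂ b) :
    EqOn ψ₁ ψ₂ B := by
  have : PreconnectedSpace B := isPreconnected_iff_preconnectedSpace.mp hB
  have sep : IsSeparatedMap (D.domRestrict p) := T2Space.isSeparatedMap _
  have linj : IsLocallyInjective (D.domRestrict p) := by
    rw [isLocallyInjective_iff_nhds]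
    rintro ⟨x, hx⟩
    obtain ⟨u, hu, hi⟩ := inj x hx
    exact ⟨Subtype.val ⁻¹' u, continuous_subtype_val.continuousAt.preimage_mem_nhds hu,
      fun y hy z hz h => Subtype.ext (hi hy hz h)⟩
  have key := sep.eq_of_comp_eq linj (A := B)
    (g₁ := fun w => (⟨ψ₁ w, m₁ w.2⟩ : D)) (g₂ := fun w => (⟨ψ₂ w, m₂ w.2⟩ : D))
    ((continuousOn_iff_continuous_domRestrict.mp c₁).subtype_mk _)
    ((continuousOn_iff_continuous_domRestrict.mp c₂).subtype_mk _)
    (funext fun w => he w w.2) ⟨b, hb⟩ (Subtype.ext hbe)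
  exact fun w hw => congrArg Subtype.val (congrFun key ⟨w, hw⟩)

section Continuation

variable {X E G : Type*} [NormedAddCommGroup X] [NormedSpace ℝ X] [CompleteSpace X]
  [NormedAddCommGroup E] [NormedSpace ℝ E] [NormedAddCommGroup G] [NormedSpace ℝ G]
  {D : Set X} {p : X → E} {q : X → G} {P : X → X ≃L[ℝ] E} {T : X → X ≃L[ℝ] G} {a : X}

theorem HasStrictFDerivAt.exists_mem_nhds_injOn {P₀ : X ≃L[ℝ] E}
    (hp : HasStrictFDerivAt p (P₀ : X →L[ℝ] E) a) : ∃ u ∈ 𝓝 a, InjOn p u := by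
  refine ⟨(hp.toOpenPartialHomeomorph p).source,
    (hp.toOpenPartialHomeomorph p).open_source.mem_nhds hp.mem_toOpenPartialHomeomorph_source, ?_⟩
  have := (hp.toOpenPartialHomeomorph p).injOn
  simpa using this

/-- The inverse of a local diffeomorphism on a set which it maps bijectively is differentiable. -/
theorem hasStrictFDerivAt_invFunOn {U : Set X} (hU : IsOpen U)
    (hp : ∀ z ∈ U, HasStrictFDerivAt p (P z : X →L[ℝ] E) z) {B : Set E} (hb : BijOn p U B)
    [Nonempty X] {w : E} (hw : w ∈ B) :
    HasStrictFDerivAt (Function.invFunOn p U)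
      ((P (Function.invFunOn p U w)).symm : E →L[ℝ] X) w := by
  have hz : Function.invFunOn p U w ∈ U := hb.surjOn.mapsTo_invFunOn hw
  have hpz : p (Function.invFunOn p U w) = w := hb.surjOn.rightInvOn_invFunOn hw
  have := (hp _ hz).to_local_left_inverse (g := Function.invFunOn p U) <| by
    filter_upwards [hU.mem_nhds hz] with x hx using hb.injOn.leftInvOn_invFunOn hx
  rwa [hpz] at this

theorem isOpen_image_of_hasStrictFDerivAt {U : Set X} (hU : IsOpen U)
    (hp : ∀ z ∈ U, HasStrictFDerivAt p (P z : X →L[ℝ] E) z) : IsOpen (p '' U) := by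
  rw [isOpen_iff_mem_nhds]
  rintro _ ⟨x, hx, rfl⟩
  rw [← (hp x hx).map_nhds_eq_of_equiv]
  exact Filter.image_mem_map (hU.mem_nhds hx)

theorem exists_isUnivalentRadius (hD : IsOpen D)
    (hp : ∀ z ∈ D, HasStrictFDerivAt p (P z : X →L[ℝ] E) z) (ha : a ∈ D) :
    ∃ r, IsUnivalentRadius D p a r := by
  obtain ⟨u, hu, hi⟩ := (hp a ha).exists_mem_nhds_injOn
  have hV : IsOpen (interior u ∩ D) := isOpen_interior.inter hD
  have haV : a ∈ interior u ∩ D := ⟨mem_interior_iff_mem_nhds.mpr hu, ha⟩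
  have hpV : ∀ z ∈ interior u ∩ D, HasStrictFDerivAt p (P z : X →L[ℝ] E) z :=
    fun z hz => hp z hz.2
  obtain ⟨r, hr, hrs⟩ := Metric.isOpen_iff.mp (isOpen_image_of_hasStrictFDerivAt hV hpV) _
    (mem_image_of_mem p haV)
  have hc : ContinuousOn p (interior u ∩ D) :=
    fun z hz => (hpV z hz).continuousAt.continuousWithinAt
  refine ⟨r, hr, (interior u ∩ D) ∩ p ⁻¹' Metric.ball (p a) r,
    hc.isOpen_inter_preimage hV Metric.isOpen_ball, fun z hz => hz.1.2,
    ⟨haV, Metric.mem_ball_self hr⟩, fun z hz => hz.2,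
    hi.mono fun z hz => interior_subset hz.1.1, fun w hw => ?_⟩
  obtain ⟨z, hz, rfl⟩ := hrs hw
  exact ⟨z, ⟨hz, hw⟩, rfl⟩

/-- Open sets around `a` which a local diffeomorphism maps bijectively onto balls around its value
at `a` are nested: the smaller ball belongs to the smaller set. -/
theorem subset_of_bijOn_ball {U V : Set X} {r s : ℝ} (hr : 0 < r) (hrs : r ≤ s)
    (hp : ∀ z ∈ D, HasStrictFDerivAt p (P z : X →L[ℝ] E) z)
    (hU : IsOpen U) (hUD : U ⊆ D) (haU : a ∈ U) (hbU : BijOn p U (Metric.ball (p a) r))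
    (hV : IsOpen V) (hVD : V ⊆ D) (haV : a ∈ V) (hbV : BijOn p V (Metric.ball (p a) s)) :
    U ⊆ V := by
  have hsub : Metric.ball (p a) r ⊆ Metric.ball (p a) s := Metric.ball_subset_ball hrs
  have key := eqOn_of_comp_eqOn_of_locallyInjOn (D := D) (p := p)
    (fun x hx => (hp x hx).exists_mem_nhds_injOn)
    (convex_ball (p a) r).isPreconnected
    (fun w hw => (hasStrictFDerivAt_invFunOn hU (fun z hz => hp z (hUD hz)) hbU
      hw).continuousAt.continuousWithinAt)
    (fun w hw => (hasStrictFDerivAt_invFunOn hV (fun z hz => hp z (hVD hz)) hbV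
      (hsub hw)).continuousAt.continuousWithinAt)
    (fun w hw => hUD (hbU.surjOn.mapsTo_invFunOn hw))
    (fun w hw => hVD (hbV.surjOn.mapsTo_invFunOn (hsub hw)))
    (fun w hw => by
      rw [hbU.surjOn.rightInvOn_invFunOn hw, hbV.surjOn.rightInvOn_invFunOn (hsub hw)])
    (Metric.mem_ball_self hr)
    (by rw [hbU.injOn.leftInvOn_invFunOn haU, hbV.injOn.leftInvOn_invFunOn haV])
  intro x hx
  have h1 := key (hbU.mapsTo hx)
  rw [hbU.injOn.leftInvOn_invFunOn hx] at h1
  rw [h1]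
  exact hbV.surjOn.mapsTo_invFunOn (hsub (hbU.mapsTo hx))

/-- A supremum of univalent radii is itself a univalent radius. -/
theorem IsUnivalentRadius.of_forall_lt {ρ : ℝ}
    (hp : ∀ z ∈ D, HasStrictFDerivAt p (P z : X →L[ℝ] E) z) (hρ : 0 < ρ)
    (h : ∀ r < ρ, ∃ s, r < s ∧ s ≤ ρ ∧ IsUnivalentRadius D p a s) : IsUnivalentRadius D p a ρ := by
  -- The witnesses for the smaller radii are nested, so their union is a witness for `ρ`.
  set S : Set (ℝ × Set X) := {x | 0 < x.1 ∧ x.1 ≤ ρ ∧ IsOpen x.2 ∧ x.2 ⊆ D ∧ a ∈ x.2 ∧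
    BijOn p x.2 (Metric.ball (p a) x.1)} with hS
  have hmem : ∀ r < ρ, ∃ x ∈ S, r < x.1 := fun r hr => by
    obtain ⟨s, hrs, hsρ, hs0, U, hU, hUD, haU, hb⟩ := h r hr
    exact ⟨(s, U), ⟨hs0, hsρ, hU, hUD, haU, hb⟩, hrs⟩
  refine ⟨hρ, ⋃ x ∈ S, x.2, isOpen_biUnion fun x hx => hx.2.2.1,
    iUnion₂_subset fun x hx => hx.2.2.2.1, ?_, ?_, ?_, ?_⟩
  · obtain ⟨x, hx, -⟩ := hmem 0 hρ
    exact mem_biUnion hx hx.2.2.2.2.1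
  · intro z hz
    obtain ⟨x, hx, hzx⟩ := mem_iUnion₂.mp hz
    exact Metric.ball_subset_ball hx.2.1 (hx.2.2.2.2.2.mapsTo hzx)
  · intro z hz w hw hzw
    obtain ⟨x, hx, hzx⟩ := mem_iUnion₂.mp hz
    obtain ⟨y, hy, hwy⟩ := mem_iUnion₂.mp hw
    obtain ⟨hx0, -, hxo, hxD, hax, hbx⟩ := hx
    obtain ⟨hy0, -, hyo, hyD, hay, hby⟩ := hy
    rcases le_total x.1 y.1 with hle | hle
    · exact hby.injOn
        (subset_of_bijOn_ball hx0 hle hp hxo hxD hax hbx hyo hyD hay hby hzx) hwy hzw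
    · exact hbx.injOn hzx
        (subset_of_bijOn_ball hy0 hle hp hyo hyD hay hby hxo hxD hax hbx hwy) hzw
  · intro w hw
    obtain ⟨x, hx, hlt⟩ := hmem _ (Metric.mem_ball.mp hw)
    obtain ⟨z, hz, rfl⟩ := hx.2.2.2.2.2.surjOn (Metric.mem_ball.mpr hlt)
    exact ⟨z, mem_biUnion hx hz, rfl⟩

/-- If the inverse branch of `p` on a ball stays in a compact subset of `D` on which `p` is
injective, then it continues to a larger ball. -/
theorem exists_isUnivalentRadius_gt [ProperSpace E] {C U : Set X} {ρ : ℝ} (hD : IsOpen D)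
    (hp : ∀ z ∈ D, HasStrictFDerivAt p (P z : X →L[ℝ] E) z) (hρ : 0 < ρ)
    (hC : IsCompact C) (hCD : C ⊆ D) (hi : InjOn p C) (haU : a ∈ U) (hUC : U ⊆ C)
    (hs : SurjOn p U (Metric.ball (p a) ρ)) :
    ∃ s, ρ < s ∧ IsUnivalentRadius D p a s := by
  have hcont : ContinuousOn p D := fun z hz => (hp z hz).continuousAt.continuousWithinAt
  have hclosed : Metric.closedBall (p a) ρ ⊆ p '' C := by
    rw [← closure_ball _ hρ.ne']
    exact closure_minimal (hs.trans (image_mono hUC)) (hC.image_of_continuousOn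
      (hcont.mono hCD)).isClosed
  obtain ⟨t, ht, hit⟩ := hi.exists_mem_nhdsSet hC (fun x hx => (hp x (hCD hx)).continuousAt)
    (fun x hx => (hp x (hCD hx)).exists_mem_nhds_injOn)
  have hV : IsOpen (interior t ∩ D) := isOpen_interior.inter hD
  have hCV : C ⊆ interior t ∩ D := subset_inter (subset_interior_iff_mem_nhdsSet.mpr ht) hCD
  obtain ⟨δ, hδ, hδs⟩ := (isCompact_closedBall (p a) ρ).exists_thickening_subset_open
    (isOpen_image_of_hasStrictFDerivAt hV fun z hz => hp z hz.2)
    (hclosed.trans (image_mono hCV))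
  rw [thickening_closedBall hδ hρ.le] at hδs
  have hpos : 0 < δ + ρ := by positivity
  refine ⟨δ + ρ, by linarith, hpos, (interior t ∩ D) ∩ p ⁻¹' Metric.ball (p a) (δ + ρ),
    (hcont.mono inter_subset_right).isOpen_inter_preimage hV Metric.isOpen_ball,
    fun z hz => hz.1.2, ⟨hCV (hUC haU), Metric.mem_ball_self hpos⟩, fun z hz => hz.2,
    hit.mono fun z hz => interior_subset hz.1.1, fun w hw => ?_⟩
  obtain ⟨z, hz, rfl⟩ := hδs hw
  exact ⟨z, ⟨hz, hw⟩, rfl⟩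

/-- If `q` is infinitesimally `L`-Lipschitz with respect to `p`, it is `L`-Lipschitz with respect to
`p` on sets which `p` maps bijectively onto a convex set. -/
theorem norm_sub_le_of_bijOn_convex {U : Set X} {B : Set E} {L : ℝ} (hU : IsOpen U)
    (hp : ∀ z ∈ U, HasStrictFDerivAt p (P z : X →L[ℝ] E) z)
    (hq : ∀ z ∈ U, HasStrictFDerivAt q (T z : X →L[ℝ] G) z)
    (hL : 0 ≤ L) (hTP : ∀ z ∈ U, ∀ v, ‖T z v‖ ≤ L * ‖P z v‖) (hb : BijOn p U B)
    (hB : Convex ℝ B) {x y : X} (hx : x ∈ U) (hy : y ∈ U) : ‖q x - q y‖ ≤ L * ‖p x - p y‖ := by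
  have hd : ∀ w ∈ B, HasFDerivWithinAt (q ∘ Function.invFunOn p U)
      ((T (Function.invFunOn p U w) : X →L[ℝ] G).comp
        ((P (Function.invFunOn p U w)).symm : E →L[ℝ] X)) B w := fun w hw =>
    ((hq _ (hb.surjOn.mapsTo_invFunOn hw)).hasFDerivAt.comp w
      (hasStrictFDerivAt_invFunOn hU hp hb hw).hasFDerivAt).hasFDerivWithinAt
  have := hB.norm_image_sub_le_of_norm_hasFDerivWithin_le hd (C := L) (fun w hw =>
    ContinuousLinearMap.opNorm_le_bound _ hL fun v => by
      simpa using hTP _ (hb.surjOn.mapsTo_invFunOn hw) ((P (Function.invFunOn p U w)).symm v))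
    (hb.mapsTo hy) (hb.mapsTo hx)
  simpa [hb.injOn.leftInvOn_invFunOn hx, hb.injOn.leftInvOn_invFunOn hy] using this

/-- The comparison principle: suppose that the local diffeomorphisms `p` and `q` satisfy
`‖Dq v‖ ≤ L ‖Dp v‖`. If `q` has a univalent disk of radius `R` around its value at `a`, then `p`
has one of radius `R / L`. Otherwise the largest univalent disk of `p` has radius `ρ < R / L`. The
branch of `p⁻¹` on it is mapped by `q` into the closed ball of radius `L ρ < R`, so it stays in a
compact subset of the domain, and it can be continued further. -/
theorem IsUnivalentRadius.div_of_norm_le [ProperSpace E] [ProperSpace G] {L R : ℝ} (hD : IsOpen D)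
    (hp : ∀ z ∈ D, HasStrictFDerivAt p (P z : X →L[ℝ] E) z)
    (hq : ∀ z ∈ D, HasStrictFDerivAt q (T z : X →L[ℝ] G) z)
    (hL : 0 < L) (hTP : ∀ z ∈ D, ∀ v, ‖T z v‖ ≤ L * ‖P z v‖)
    (hR : IsUnivalentRadius D q a R) : IsUnivalentRadius D p a (R / L) := by
  obtain ⟨hR0, U, hU, hUD, haU, hbU⟩ := hR
  have hRL : 0 < R / L := by positivity
  set S : Set ℝ := {r | r ≤ R / L ∧ IsUnivalentRadius D p a r} with hS
  have hSb : BddAbove S := ⟨R / L, fun r hr => hr.1⟩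
  -- Univalent radii can be decreased.
  have hmono : ∀ r s, 0 < r → r ≤ s → IsUnivalentRadius D p a s → IsUnivalentRadius D p a r := by
    rintro r s hr hrs ⟨hs, V, hV, hVD, haV, hbV⟩
    refine ⟨hr, V ∩ p ⁻¹' Metric.ball (p a) r,
      ContinuousOn.isOpen_inter_preimage (fun z hz => (hp z
        (hVD hz)).continuousAt.continuousWithinAt) hV Metric.isOpen_ball,
      fun z hz => hVD hz.1, ⟨haV, Metric.mem_ball_self hr⟩, fun z hz => hz.2,
      hbV.injOn.mono inter_subset_left, fun w hw => ?_⟩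
    obtain ⟨z, hz, rfl⟩ := hbV.surjOn (Metric.ball_subset_ball hrs hw)
    exact ⟨z, ⟨hz, hw⟩, rfl⟩
  -- The largest univalent radius of `p` at `a`, cut off at `R / L`, is attained.
  obtain ⟨r₀, hr₀⟩ := exists_isUnivalentRadius hD hp (hUD haU)
  have hmin : min r₀ (R / L) ∈ S :=
    ⟨min_le_right _ _, hmono _ _ (lt_min hr₀.1 hRL) (min_le_left _ _) hr₀⟩
  have hρ0 : 0 < sSup S := (lt_min hr₀.1 hRL).trans_le (le_csSup hSb hmin)
  have hρ : IsUnivalentRadius D p a (sSup S) :=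
    IsUnivalentRadius.of_forall_lt hp hρ0 fun r hr => by
      obtain ⟨s, hs, hrs⟩ := exists_lt_of_lt_csSup ⟨_, hmin⟩ hr
      exact ⟨s, hrs, le_csSup hSb hs, hs.2⟩
  rcases (csSup_le ⟨_, hmin⟩ fun r hr => hr.1 : sSup S ≤ R / L).eq_or_lt with heq | hlt
  · rwa [heq] at hρ
  exfalso
  obtain ⟨-, V, hV, hVD, haV, hbV⟩ := hρ
  have hlip : ∀ x ∈ V, ∀ y ∈ V, ‖q x - q y‖ ≤ L * ‖p x - p y‖ := fun x hx y hy =>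
    norm_sub_le_of_bijOn_convex hV (fun z hz => hp z (hVD hz)) (fun z hz => hq z (hVD hz)) hL.le
      (fun z hz => hTP z (hVD hz)) hbV (convex_ball _ _) hx hy
  have hLρ : L * sSup S < R := by rwa [lt_div_iff₀ hL, mul_comm] at hlt
  have hqV : MapsTo q V (Metric.closedBall (q a) (L * sSup S)) := fun z hz => by
    rw [mem_closedBall_iff_norm]
    refine (hlip z hz a haV).trans (mul_le_mul_of_nonneg_left ?_ hL.le)
    exact (mem_ball_iff_norm.mp (hbV.mapsTo hz)).le
  have hsub : Metric.closedBall (q a) (L * sSup S) ⊆ Metric.ball (q a) R :=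
    Metric.closedBall_subset_ball hLρ
  have hχ : ContinuousOn (Function.invFunOn q U) (Metric.ball (q a) R) := fun w hw =>
    (hasStrictFDerivAt_invFunOn hU (fun z hz => hq z (hUD hz)) hbU
      hw).continuousAt.continuousWithinAt
  set K : Set X := Function.invFunOn q U '' Metric.closedBall (q a) (L * sSup S) with hK
  have hKc : IsCompact K := (isCompact_closedBall _ _).image_of_continuousOn (hχ.mono hsub)
  have hKU : K ⊆ U := by
    rintro _ ⟨w, hw, rfl⟩
    exact hbU.surjOn.mapsTo_invFunOn (hsub hw)
  have hψ : ContinuousOn (Function.invFunOn p V) (Metric.ball (p a) (sSup S)) := fun w hw =>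
    (hasStrictFDerivAt_invFunOn hV (fun z hz => hp z (hVD hz)) hbV
      hw).continuousAt.continuousWithinAt
  have hmψ : MapsTo (Function.invFunOn p V) (Metric.ball (p a) (sSup S)) V :=
    hbV.surjOn.mapsTo_invFunOn
  have hqψ : MapsTo (q ∘ Function.invFunOn p V) (Metric.ball (p a) (sSup S))
      (Metric.ball (q a) R) := fun w hw => hsub (hqV (hmψ hw))
  -- Both sides are lifts of the same map through `q`.
  have key : EqOn (Function.invFunOn p V)
      (Function.invFunOn q U ∘ (q ∘ Function.invFunOn p V)) (Metric.ball (p a) (sSup S)) := by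
    refine eqOn_of_comp_eqOn_of_locallyInjOn (D := D) (p := q)
      (fun x hx => (hq x hx).exists_mem_nhds_injOn) (convex_ball _ _).isPreconnected hψ
      (hχ.comp (ContinuousOn.comp (t := D) (fun z hz => (hq z hz).continuousAt.continuousWithinAt)
        hψ fun w hw => hVD (hmψ hw)) hqψ)
      (fun w hw => hVD (hmψ hw)) (fun w hw => hUD (hbU.surjOn.mapsTo_invFunOn (hqψ hw)))
      (fun w hw => (hbU.surjOn.rightInvOn_invFunOn (hqψ hw)).symm) (Metric.mem_ball_self hρ0) ?_
    simp only [Function.comp_apply, hbV.injOn.leftInvOn_invFunOn haV,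
      hbU.injOn.leftInvOn_invFunOn haU]
  have hVK : V ⊆ K := fun x hx => by
    have h1 := key (hbV.mapsTo hx)
    simp only [Function.comp_apply, hbV.injOn.leftInvOn_invFunOn hx] at h1
    exact ⟨q x, hqV hx, h1.symm⟩
  have hCK : closure V ⊆ K := closure_minimal hVK hKc.isClosed
  have hCD : closure V ⊆ D := hCK.trans (hKU.trans hUD)
  -- The Lipschitz estimate passes to the closure; as `q` is injective there, so is `p`.
  have hlip' : ∀ x ∈ closure V, ∀ y ∈ closure V, ‖q x - q y‖ ≤ L * ‖p x - p y‖ := by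
    intro x hx y hy
    have cp : ContinuousOn p (closure V) :=
      fun z hz => (hp z (hCD hz)).continuousAt.continuousWithinAt
    have cq : ContinuousOn q (closure V) :=
      fun z hz => (hq z (hCD hz)).continuousAt.continuousWithinAt
    have hxy : (x, y) ∈ closure (V ×ˢ V) := by
      rw [closure_prod_eq]
      exact ⟨hx, hy⟩
    refine le_on_closure (s := V ×ˢ V) (f := fun z : X × X => ‖q z.1 - q z.2‖)
      (g := fun z : X × X => L * ‖p z.1 - p z.2‖) (fun z hz => hlip _ hz.1 _ hz.2) ?_ ?_ hxy
    all_goals rw [closure_prod_eq]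
    · exact ((cq.comp continuousOn_fst fun z hz => hz.1).sub
        (cq.comp continuousOn_snd fun z hz => hz.2)).norm
    · exact continuousOn_const.mul ((cp.comp continuousOn_fst fun z hz => hz.1).sub
        (cp.comp continuousOn_snd fun z hz => hz.2)).norm
  have hinj : InjOn p (closure V) := fun x hx y hy hxy => by
    have h1 := hlip' x hx y hy
    rw [hxy, sub_self, norm_zero, mul_zero] at h1
    exact hbU.injOn (hKU (hCK hx)) (hKU (hCK hy)) (sub_eq_zero.mp (norm_le_zero_iff.mp h1))
  obtain ⟨s, hs, hsu⟩ := exists_isUnivalentRadius_gt hD hp hρ0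
    (hKc.of_isClosed_subset isClosed_closure hCK) hCD hinj haV subset_closure hbV.surjOn
  have : min s (R / L) ∈ S :=
    ⟨min_le_right _ _, hmono _ _ (lt_min hsu.1 hRL) (min_le_left _ _) hsu⟩
  exact (lt_min hs hlt).not_ge (le_csSup hSb this)

end Continuation

/-! ### Distortion of univalent disks by harmonic mappings -/

/-- A harmonic mapping `h + conj g` with `|g'| < |h'|` is a local diffeomorphism, with real
derivative `v ↦ h' v + conj (g' v)`. -/
theorem exists_hasStrictFDerivAt_harmonic {f h g : ℂ → ℂ} (hh : DifferentiableOn ℂ h unitDisk)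
    (hg : DifferentiableOn ℂ g unitDisk) (hf : ∀ z ∈ unitDisk, f z = h z + conj (g z))
    (hlt : ∀ z ∈ unitDisk, ‖deriv g z‖ < ‖deriv h z‖) :
    ∃ P : ℂ → ℂ ≃L[ℝ] ℂ, ∀ z ∈ unitDisk, HasStrictFDerivAt f (P z : ℂ →L[ℝ] ℂ) z ∧
      ∀ v, P z v = deriv h z * v + conj (deriv g z * v) := by
  have key : ∀ z : ℂ, ∃ P : ℂ ≃L[ℝ] ℂ, z ∈ unitDisk →
      HasStrictFDerivAt f (P : ℂ →L[ℝ] ℂ) z ∧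
        ∀ v, P v = deriv h z * v + conj (deriv g z * v) := by
    intro z
    by_cases hz : z ∈ unitDisk
    swap
    · exact ⟨ContinuousLinearEquiv.refl ℝ ℂ, fun h => absurd h hz⟩
    have hD : unitDisk ∈ 𝓝 z := Metric.isOpen_ball.mem_nhds hz
    have dh : HasStrictFDerivAt h _ z :=
      (hh.analyticAt hD).hasStrictDerivAt.hasStrictFDerivAt.restrictScalars ℝ
    have dg : HasStrictFDerivAt g _ z :=
      (hg.analyticAt hD).hasStrictDerivAt.hasStrictFDerivAt.restrictScalars ℝ
    have df := dh.add ((Complex.conjCLE : ℂ →L[ℝ] ℂ).hasStrictFDerivAt.comp z dg)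
    have df' := df.congr_of_eventuallyEq (f₁ := f) <| by
      filter_upwards [hD] with x hx using by simp [hf x hx]
    set L : ℂ →L[ℝ] ℂ := _ + _ with hL
    have hLv : ∀ v, L v = deriv h z * v + conj (deriv g z * v) := fun v => by
      simp [hL, mul_comm]
    have hinj : Function.Injective L := by
      rw [injective_iff_map_eq_zero]
      intro v hv
      rw [hLv, add_eq_zero_iff_eq_neg] at hv
      have h1 := congrArg norm hv
      rw [norm_neg, RCLike.norm_conj, norm_mul, norm_mul] at h1
      by_contra hv0
      exact (mul_lt_mul_of_pos_right (hlt z hz) (norm_pos_iff.mpr hv0)).ne' h1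
    refine ⟨(LinearEquiv.ofInjectiveEndo (L : ℂ →ₗ[ℝ] ℂ) hinj).toContinuousLinearEquiv,
      fun _ => ⟨?_, hLv⟩⟩
    exact df'
  choose P hP using key
  exact ⟨P, hP⟩

theorem univalentRadius_le_mul {F G : ℂ → ℂ} {a : ℂ} {L : ℝ} (hL : 0 < L)
    (h : ∀ r, IsUnivalentRadius unitDisk F a r → IsUnivalentRadius unitDisk G a (r / L)) :
    univalentRadius F a ≤ ENNReal.ofReal L * univalentRadius G a := by
  refine iSup₂_le fun r hr => ?_
  have h1 : ENNReal.ofReal (r / L) ≤ univalentRadius G a :=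
    le_iSup₂ (f := fun (r : ℝ) (_ : 0 < r ∧ ∃ U : Set ℂ, IsOpen U ∧ U ⊆ unitDisk ∧ a ∈ U ∧
      BijOn G U (Metric.ball (G a) r)) => ENNReal.ofReal r) (r / L) (h r hr)
  calc ENNReal.ofReal r = ENNReal.ofReal L * ENNReal.ofReal (r / L) := by
        rw [← ENNReal.ofReal_mul hL.le, mul_div_cancel₀ _ hL.ne']
    _ ≤ _ := by gcongr

/-- For `f = h + conj g` with dilatation at most `k = (Q - 1) / (Q + 1)`, the derivatives of `f` and
of `H = h / h'(0)` are comparable up to the factor `Q`: `|Df v|` lies between `(1 - k) |h' v|` and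
`(1 + k) |h' v|`, while the normalization places `|h'(0)|` between `1 / (1 + k)` and
`1 / (1 - k)`. -/
theorem univalentRadius_bounds {α : ℝ≥0∞} {Q : ℝ} (hQ : 1 ≤ Q) {f h g : ℂ → ℂ}
    (hf : MemHarmonicFamily α Q f h g) (z : ℂ) :
    univalentRadius (normalizedPart h) z / ENNReal.ofReal Q ≤ univalentRadius f z ∧
      univalentRadius f z ≤ ENNReal.ofReal Q * univalentRadius (normalizedPart h) z := by
  have hD : IsOpen unitDisk := Metric.isOpen_ball
  have h0D : (0 : ℂ) ∈ unitDisk := Metric.mem_ball_self one_pos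
  have hQ0 : 0 < Q := by linarith
  obtain ⟨M, hM, -, hHM⟩ := hf.normalizedPart_mem
  have hdH : ∀ z, deriv (normalizedPart h) z = deriv h z / deriv h 0 := fun z =>
    deriv_div_const (c := h) _
  have hH0 : ∀ z ∈ unitDisk, deriv (normalizedPart h) z ≠ 0 := hM.locallyUnivalent _ hHM
  have hh : ∀ z ∈ unitDisk, deriv h z ≠ 0 := fun z hz h0 => hH0 z hz (by simp [hdH, h0])
  set k := (Q - 1) / (Q + 1) with hk
  have hk0 : 0 ≤ k := by rw [hk]; apply div_nonneg <;> linarith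
  have hk1 : k < 1 := by rw [hk, div_lt_one (by linarith)]; linarith
  have hkQ : 1 + k = Q * (1 - k) := by rw [hk]; field_simp; ring
  have hdil : ∀ z ∈ unitDisk, ‖deriv g z‖ ≤ k * ‖deriv h z‖ := fun z hz => by
    have := hf.dilatation_le z hz
    rwa [norm_div, div_le_iff₀ (norm_pos_iff.mpr (hh z hz))] at this
  obtain ⟨T, hT⟩ := exists_hasStrictFDerivAt_harmonic hf.analytic_h hf.analytic_g
    hf.decomposition fun z hz => (hdil z hz).trans_lt
      (mul_lt_of_lt_one_left (norm_pos_iff.mpr (hh z hz)) hk1)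
  obtain ⟨P, hP⟩ := exists_hasStrictFDerivAt_harmonic (f := normalizedPart h)
    (h := normalizedPart h) (g := fun _ => 0)
    (hf.analytic_h.div_const (deriv h 0)) (differentiableOn_const 0) (by simp)
    (fun z hz => by simpa only [deriv_const, norm_zero] using norm_pos_iff.mpr (hH0 z hz))
  have hPn : ∀ z ∈ unitDisk, ∀ v, ‖deriv h z * v‖ = ‖deriv h 0‖ * ‖P z v‖ := fun z hz v => by
    rw [(hP z hz).2, hdH, ← norm_mul]
    congr 1
    have := hh 0 h0D
    simp only [deriv_const, zero_mul, map_zero, add_zero]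
    field_simp
  have hgn : ∀ z ∈ unitDisk, ∀ v, ‖conj (deriv g z * v)‖ ≤ k * ‖deriv h z * v‖ :=
    fun z hz v => by
      rw [RCLike.norm_conj, norm_mul, norm_mul, ← mul_assoc]
      exact mul_le_mul_of_nonneg_right (hdil z hz) (norm_nonneg v)
  have hn1 : ‖deriv h 0 + conj (deriv g 0)‖ = 1 := by rw [hf.normalization, norm_one]
  have hg0 : ‖conj (deriv g 0)‖ ≤ k * ‖deriv h 0‖ := by
    rw [RCLike.norm_conj]; exact hdil 0 h0D
  have hup : (1 - k) * ‖deriv h 0‖ ≤ 1 := by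
    have := norm_sub_le_norm_add (deriv h 0) (conj (deriv g 0))
    linarith
  have hlo : 1 ≤ (1 + k) * ‖deriv h 0‖ := by
    have := norm_add_le (deriv h 0) (conj (deriv g 0))
    linarith
  have hTP : ∀ z ∈ unitDisk, ∀ v, ‖T z v‖ ≤ Q * ‖P z v‖ := fun z hz v => by
    calc ‖T z v‖ ≤ ‖deriv h z * v‖ + ‖conj (deriv g z * v)‖ := by
          rw [(hT z hz).2]; exact norm_add_le _ _
      _ ≤ (1 + k) * ‖deriv h z * v‖ := by linarith [hgn z hz v]
      _ = Q * (((1 - k) * ‖deriv h 0‖) * ‖P z v‖) := by rw [hPn z hz, hkQ]; ring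
      _ ≤ Q * (1 * ‖P z v‖) := by gcongr
      _ = Q * ‖P z v‖ := by rw [one_mul]
  have hPT : ∀ z ∈ unitDisk, ∀ v, ‖P z v‖ ≤ Q * ‖T z v‖ := fun z hz v => by
    have h1 := norm_sub_le_norm_add (deriv h z * v) (conj (deriv g z * v))
    rw [← (hT z hz).2] at h1
    calc ‖P z v‖ = 1 * ‖P z v‖ := (one_mul _).symm
      _ ≤ ((1 + k) * ‖deriv h 0‖) * ‖P z v‖ := by gcongr
      _ = Q * ((1 - k) * ‖deriv h z * v‖) := by rw [hPn z hz, hkQ]; ring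
      _ ≤ Q * ‖T z v‖ := by
        refine mul_le_mul_of_nonneg_left ?_ hQ0.le
        linarith [hgn z hz v]
  refine ⟨ENNReal.div_le_of_le_mul' (univalentRadius_le_mul hQ0 fun r hr => ?_),
    univalentRadius_le_mul hQ0 fun r hr => ?_⟩
  · exact hr.div_of_norm_le hD (fun z hz => (hT z hz).1) (fun z hz => (hP z hz).1) hQ0 hPT
  · exact hr.div_of_norm_le hD (fun z hz => (hP z hz).1) (fun z hz => (hT z hz).1) hQ0 hTP

/-! ### Half-plane mappings -/

/-- For `|c| = 1`, the conformal mapping `z ↦ z / (1 - c z)` of the unit disk onto the half-plane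
`Re (c w) > -1/2`. -/
noncomputable def halfPlaneMap (c z : ℂ) : ℂ := z / (1 - c * z)

theorem one_sub_mul_ne_zero {c z : ℂ} (hc : ‖c‖ = 1) (hz : z ∈ unitDisk) : 1 - c * z ≠ 0 := by
  intro h
  have h1 := congrArg norm (sub_eq_zero.mp h)
  rw [norm_one, norm_mul, hc, one_mul] at h1
  exact (mem_ball_zero_iff.mp hz).ne h1.symm

theorem hasDerivAt_halfPlaneMap {c z : ℂ} (h : 1 - c * z ≠ 0) :
    HasDerivAt (halfPlaneMap c) (1 / (1 - c * z) ^ 2) z := by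
  have h1 : HasDerivAt (fun z : ℂ => 1 - c * z) (-c) z := by
    simpa using ((hasDerivAt_id z).const_mul c).const_sub 1
  convert! (hasDerivAt_id z).div h1 h using 1
  simp only [id]
  ring

theorem iteratedDeriv_two_halfPlaneMap (c : ℂ) : iteratedDeriv 2 (halfPlaneMap c) 0 = 2 * c := by
  have hcont : ContinuousAt (fun z : ℂ => 1 - c * z) 0 := by fun_prop
  have hev : deriv (halfPlaneMap c) =ᶠ[𝓝 0] fun z => 1 / (1 - c * z) ^ 2 := by
    filter_upwards [hcont.eventually_ne (y := 0) (by simp)] with z hz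
    exact (hasDerivAt_halfPlaneMap hz).deriv
  rw [iteratedDeriv_succ, iteratedDeriv_one, hev.deriv_eq]
  have h1 : HasDerivAt (fun z : ℂ => 1 - c * z) (-c) 0 := by
    simpa using ((hasDerivAt_id (0 : ℂ)).const_mul c).const_sub 1
  have h2 := (hasDerivAt_const (0 : ℂ) (1 : ℂ)).div (h1.pow 2) (by simp)
  exact h2.deriv.trans (by simp)

theorem diskAut_mem_unitDisk {a z : ℂ} (θ : ℝ) (ha : ‖a‖ < 1) (hz : z ∈ unitDisk) :
    diskAut a θ z ∈ unitDisk ∧ 1 + conj a * z ≠ 0 := by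
  have hz1 : ‖z‖ < 1 := mem_ball_zero_iff.mp hz
  have hne : 1 + conj a * z ≠ 0 := by
    intro h
    have h1 := congrArg norm (add_eq_zero_iff_eq_neg.mp h)
    rw [norm_one, norm_neg, norm_mul, RCLike.norm_conj] at h1
    nlinarith [norm_nonneg a, norm_nonneg z]
  refine ⟨mem_ball_zero_iff.mpr ?_, hne⟩
  rw [diskAut, norm_mul, Complex.norm_exp_ofReal_mul_I, one_mul, norm_div,
    div_lt_one (norm_pos_iff.mpr hne)]
  refine lt_of_pow_lt_pow_left₀ 2 (norm_nonneg _) ?_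
  have ha2 : ‖a‖ ^ 2 < 1 := by nlinarith [norm_nonneg a]
  have hz2 : ‖z‖ ^ 2 < 1 := by nlinarith [norm_nonneg z]
  rw [← Complex.normSq_eq_norm_sq, Complex.normSq_apply] at ha2 hz2 ⊢
  rw [← Complex.normSq_eq_norm_sq, Complex.normSq_apply]
  simp
  nlinarith [mul_pos (sub_pos.mpr ha2) (sub_pos.mpr hz2)]

/-- The algebra behind the linear invariance of half-plane mappings: with `b = conj a`, composing
`z / (1 - c z)` with `u (z + a) / (1 + b z)` and normalizing gives a map of the same form. -/
theorem halfPlaneMap_mobius_identity {a b c u z : ℂ} (hne : 1 + b * z ≠ 0)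
    (hd : 1 - c * u * a ≠ 0) (hu : u ≠ 0) (hab : 1 - a * b ≠ 0)
    (h : 1 - c * (u * ((z + a) / (1 + b * z))) ≠ 0) :
    halfPlaneMap ((c * u - b) / (1 - c * u * a)) z =
      (halfPlaneMap c (u * ((z + a) / (1 + b * z))) - halfPlaneMap c (u * a)) /
        (1 / (1 - c * (u * a)) ^ 2 * (u * (1 - a * b))) := by
  have h4 : 1 - c * (u * ((z + a) / (1 + b * z))) =
      ((1 - c * u * a) - (c * u - b) * z) / (1 + b * z) := by
    rw [eq_div_iff hne]
    linear_combination -(c * u) * div_mul_cancel₀ (z + a) hne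
  have h2 : (1 - c * u * a) - (c * u - b) * z ≠ 0 := by
    intro h0
    rw [h4, h0, zero_div] at h
    exact h rfl
  have h5 : 1 - (c * u - b) / (1 - c * u * a) * z =
      ((1 - c * u * a) - (c * u - b) * z) / (1 - c * u * a) := by
    field_simp
  have h6 : 1 - c * (u * a) = 1 - c * u * a := by ring
  rw [halfPlaneMap, halfPlaneMap, halfPlaneMap, h4, h5, h6]
  generalize hA : (1 - c * u * a) - (c * u - b) * z = A at *
  generalize hB : 1 - c * u * a = B at *
  generalize hC : 1 + b * z = C at *
  generalize hE : 1 - a * b = F at *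
  field_simp
  subst hA hB hC hE
  ring

/-- The half-plane mappings are permuted by the transforms defining linear invariance. -/
theorem linTransform_halfPlaneMap {a c : ℂ} {θ : ℝ} (hc : ‖c‖ = 1) (ha : ‖a‖ < 1) :
    ∃ c' : ℂ, ‖c'‖ = 1 ∧
      EqOn (halfPlaneMap c') (linTransform (halfPlaneMap c) (diskAut a θ)) unitDisk := by
  set u := Complex.exp (θ * Complex.I) with hu
  have hun : ‖u‖ = 1 := Complex.norm_exp_ofReal_mul_I θ
  have hu0 : u ≠ 0 := Complex.exp_ne_zero _
  have haD : a ∈ unitDisk := mem_ball_zero_iff.mpr ha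
  have hcu : ‖c * u‖ = 1 := by rw [norm_mul, hc, hun, one_mul]
  have hd : 1 - c * u * a ≠ 0 := one_sub_mul_ne_zero hcu haD
  have hφ0 : diskAut a θ 0 = u * a := by simp [diskAut, hu]
  have haa : 1 - a * conj a ≠ 0 := by
    rw [Complex.mul_conj, Complex.normSq_eq_norm_sq]
    norm_cast
    nlinarith [norm_nonneg a]
  have hdφ : HasDerivAt (diskAut a θ) (u * (1 - a * conj a)) 0 := by
    have h1 : HasDerivAt (fun z : ℂ => 1 + conj a * z) (conj a) 0 := by
      simpa using ((hasDerivAt_id (0 : ℂ)).const_mul (conj a)).const_add 1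
    have h2 := ((((hasDerivAt_id (0 : ℂ)).add_const a).div h1 (by simp)).const_mul u)
    convert! h2 using 1
    simp
  refine ⟨(c * u - conj a) / (1 - c * u * a), ?_, fun z hz => ?_⟩
  · have h1 : c * u - conj a = c * u * conj (1 - c * u * a) := by
      have : c * u * conj (c * u) = 1 := by
        rw [Complex.mul_conj, Complex.normSq_eq_norm_sq, hcu]; norm_num
      rw [map_sub, map_one, map_mul conj (c * u)]
      linear_combination conj a * this
    rw [norm_div, h1, norm_mul, hcu, one_mul, RCLike.norm_conj, div_self (norm_ne_zero_iff.mpr hd)]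
  · obtain ⟨hφz, hne⟩ := diskAut_mem_unitDisk θ ha hz
    have h1 := one_sub_mul_ne_zero hc hφz
    have h0 : 1 - c * diskAut a θ 0 ≠ 0 := by rw [hφ0, ← mul_assoc]; exact hd
    rw [linTransform, hdφ.deriv, (hasDerivAt_halfPlaneMap h0).deriv, hφ0]
    exact halfPlaneMap_mobius_identity hne hd hu0 haa (by simpa only [diskAut, ← hu] using h1)

theorem isLIF_halfPlaneMap : IsLIF {F | ∃ c : ℂ, ‖c‖ = 1 ∧ F = halfPlaneMap c} where
  nonempty := ⟨_, 1, norm_one, rfl⟩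
  analytic := by
    rintro _ ⟨c, hc, rfl⟩ z hz
    exact (hasDerivAt_halfPlaneMap
      (one_sub_mul_ne_zero hc hz)).differentiableAt.differentiableWithinAt
  locallyUnivalent := by
    rintro _ ⟨c, hc, rfl⟩ z hz
    rw [(hasDerivAt_halfPlaneMap (one_sub_mul_ne_zero hc hz)).deriv]
    exact one_div_ne_zero (pow_ne_zero 2 (one_sub_mul_ne_zero hc hz))
  map_zero := by
    rintro _ ⟨c, hc, rfl⟩
    simp [halfPlaneMap]
  deriv_zero := by
    rintro _ ⟨c, hc, rfl⟩
    rw [(hasDerivAt_halfPlaneMap (by simp)).deriv]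
    simp
  invariant := by
    rintro _ ⟨c, hc, rfl⟩ a θ ha
    obtain ⟨c', hc', he⟩ := linTransform_halfPlaneMap (θ := θ) hc ha
    exact ⟨_, ⟨c', hc', rfl⟩, he⟩

theorem halfPlaneMap_mem_universalLIF {α : ℝ≥0∞} (hα : 1 ≤ α) {c : ℂ} (hc : ‖c‖ = 1) :
    halfPlaneMap c ∈ universalLIF α := by
  refine ⟨_, isLIF_halfPlaneMap, iSup₂_le ?_, c, hc, rfl⟩
  rintro _ ⟨c', hc', rfl⟩
  rw [iteratedDeriv_two_halfPlaneMap, mul_div_cancel_left₀ _ two_ne_zero, ← ofReal_norm, hc']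
  simpa using hα

/-! ### Stretched half-plane mappings -/

/-- The harmonic mapping `Re H + i s Im H`, where `H` maps the unit disk conformally onto the
half-plane `Im w > -1/2`, as a sum of an analytic and a co-analytic part. -/
noncomputable def stretchedHalfPlaneMap (s : ℝ) (z : ℂ) : ℂ :=
  ((1 + s) / 2 : ℂ) * halfPlaneMap (-Complex.I) z +
    conj (((1 - s) / 2 : ℂ) * halfPlaneMap (-Complex.I) z)

theorem stretchedHalfPlaneMap_re (s : ℝ) (z : ℂ) :
    (stretchedHalfPlaneMap s z).re = (halfPlaneMap (-Complex.I) z).re := by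
  rw [stretchedHalfPlaneMap, ← Complex.ofReal_one, ← Complex.ofReal_ofNat, ← Complex.ofReal_add,
    ← Complex.ofReal_sub, ← Complex.ofReal_div, ← Complex.ofReal_div]
  simp only [Complex.add_re, Complex.conj_re, Complex.re_ofReal_mul]
  ring

theorem stretchedHalfPlaneMap_im (s : ℝ) (z : ℂ) :
    (stretchedHalfPlaneMap s z).im = s * (halfPlaneMap (-Complex.I) z).im := by
  rw [stretchedHalfPlaneMap, ← Complex.ofReal_one, ← Complex.ofReal_ofNat, ← Complex.ofReal_add,
    ← Complex.ofReal_sub, ← Complex.ofReal_div, ← Complex.ofReal_div]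
  simp only [Complex.add_im, Complex.conj_im, Complex.im_ofReal_mul]
  ring

theorem norm_neg_I : ‖-Complex.I‖ = 1 := by simp

theorem one_add_mul_halfPlaneMap {c z : ℂ} (h : 1 - c * z ≠ 0) :
    1 + c * halfPlaneMap c z = 1 / (1 - c * z) := by
  rw [eq_div_iff h, halfPlaneMap]
  linear_combination c * div_mul_cancel₀ z h

theorem halfPlaneMap_neg_halfPlaneMap {c z : ℂ} (h : 1 - c * z ≠ 0) :
    halfPlaneMap (-c) (halfPlaneMap c z) = z := by
  rw [halfPlaneMap, neg_mul, sub_neg_eq_add, one_add_mul_halfPlaneMap h, div_div_eq_mul_div,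
    div_one, halfPlaneMap, div_mul_cancel₀ _ h]

/-- The inverse is `w ↦ w / (1 - i w)`, and `|w| < |1 - i w|` means `Im w > -1/2`. -/
theorem halfPlaneMap_bijOn :
    BijOn (halfPlaneMap (-Complex.I)) unitDisk {w | -1 / 2 < w.im} := by
  have hnormSq : ∀ w : ℂ, ‖1 - Complex.I * w‖ ^ 2 - ‖w‖ ^ 2 = 1 + 2 * w.im := fun w => by
    rw [← Complex.normSq_eq_norm_sq, ← Complex.normSq_eq_norm_sq, Complex.normSq_apply,
      Complex.normSq_apply]
    simp
    ring
  have hinv : ∀ z ∈ unitDisk, halfPlaneMap Complex.I (halfPlaneMap (-Complex.I) z) = z :=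
    fun z hz => by
      simpa only [neg_neg] using halfPlaneMap_neg_halfPlaneMap (one_sub_mul_ne_zero norm_neg_I hz)
  refine ⟨fun z hz => ?_, fun z hz w hw hzw => ?_, fun w hw => ?_⟩
  · have h1 := one_sub_mul_ne_zero norm_neg_I hz
    have hne : 1 - Complex.I * halfPlaneMap (-Complex.I) z ≠ 0 := by
      have := one_add_mul_halfPlaneMap h1
      rw [neg_mul, ← sub_eq_add_neg] at this
      rw [this]
      exact one_div_ne_zero h1
    have hz1 : ‖z‖ < 1 := mem_ball_zero_iff.mp hz
    rw [← hinv z hz, halfPlaneMap, norm_div, div_lt_one (norm_pos_iff.mpr hne)] at hz1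
    have h3 := hnormSq (halfPlaneMap (-Complex.I) z)
    have h4 := pow_lt_pow_left₀ hz1 (norm_nonneg _) two_ne_zero
    rw [mem_ofPred_eq]
    linarith
  · rw [← hinv z hz, ← hinv w hw, hzw]
  · rw [mem_ofPred_eq] at hw
    have h3 := hnormSq w
    have h4 : ‖w‖ < ‖1 - Complex.I * w‖ :=
      lt_of_pow_lt_pow_left₀ 2 (norm_nonneg _) (by linarith)
    have hne : 1 - Complex.I * w ≠ 0 := norm_pos_iff.mp ((norm_nonneg _).trans_lt h4)
    refine ⟨halfPlaneMap Complex.I w, mem_ball_zero_iff.mpr ?_, halfPlaneMap_neg_halfPlaneMap hne⟩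
    rwa [halfPlaneMap, norm_div, div_lt_one (norm_pos_iff.mpr hne)]

theorem stretchedHalfPlaneMap_bijOn {s : ℝ} (hs : 0 < s) :
    BijOn (stretchedHalfPlaneMap s) unitDisk {w | -(s / 2) < w.im} := by
  refine ⟨fun z hz => ?_, fun z hz w hw hzw => ?_, fun w hw => ?_⟩
  · have h1 := halfPlaneMap_bijOn.mapsTo hz
    rw [mem_ofPred_eq] at h1 ⊢
    rw [stretchedHalfPlaneMap_im]
    nlinarith
  · refine halfPlaneMap_bijOn.injOn hz hw (Complex.ext ?_ ?_)
    · rw [← stretchedHalfPlaneMap_re s, hzw, stretchedHalfPlaneMap_re]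
    · have h1 := congrArg Complex.im hzw
      rw [stretchedHalfPlaneMap_im, stretchedHalfPlaneMap_im] at h1
      exact mul_left_cancel₀ hs.ne' h1
  · obtain ⟨z, hz, hzw⟩ := halfPlaneMap_bijOn.surjOn (a := ⟨w.re, w.im / s⟩) <| by
      rw [mem_ofPred_eq] at hw ⊢
      rw [lt_div_iff₀ hs]
      linarith
    refine ⟨z, hz, Complex.ext ?_ ?_⟩
    · rw [stretchedHalfPlaneMap_re, hzw]
    · rw [stretchedHalfPlaneMap_im, hzw]
      exact mul_div_cancel₀ _ hs.ne'

theorem differentiableOn_halfPlaneMap_neg_I :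
    DifferentiableOn ℂ (halfPlaneMap (-Complex.I)) unitDisk :=
  isLIF_halfPlaneMap.analytic _ ⟨_, norm_neg_I, rfl⟩

theorem stretchedHalfPlaneMap_zero (s : ℝ) : stretchedHalfPlaneMap s 0 = 0 := by
  simp [stretchedHalfPlaneMap, halfPlaneMap]

/-- The image is the half-plane `Im w > -s/2`, whose boundary has distance `s / 2` from `0`. -/
theorem univalentRadius_stretchedHalfPlaneMap {s : ℝ} (hs : 0 < s) :
    univalentRadius (stretchedHalfPlaneMap s) 0 = ENNReal.ofReal (s / 2) := by
  have hbij := stretchedHalfPlaneMap_bijOn hs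
  apply le_antisymm
  · -- The boundary point `-i s / 2` of the image is omitted.
    refine iSup₂_le fun r hr => ENNReal.ofReal_le_ofReal ?_
    obtain ⟨hr0, U, -, hUD, -, hb⟩ := hr
    by_contra! hlt
    rw [stretchedHalfPlaneMap_zero] at hb
    obtain ⟨z, hz, he⟩ := hb.surjOn (a := -((s / 2 : ℝ) * Complex.I)) <| by
      rw [mem_ball_zero_iff, norm_neg, norm_mul, Complex.norm_I, mul_one, Complex.norm_real,
        Real.norm_of_nonneg (by positivity)]
      exact hlt
    have h1 := hbij.mapsTo (hUD hz)
    rw [he, mem_ofPred_eq] at h1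
    simp at h1
  · have hcont : ContinuousOn (stretchedHalfPlaneMap s) unitDisk := by
      have := differentiableOn_halfPlaneMap_neg_I.continuousOn
      exact (continuousOn_const.mul this).add
        (Complex.continuous_conj.comp_continuousOn (continuousOn_const.mul this))
    refine le_iSup₂ (f := fun (r : ℝ) (_ : 0 < r ∧ ∃ U : Set ℂ, IsOpen U ∧ U ⊆ unitDisk ∧
      (0 : ℂ) ∈ U ∧ BijOn (stretchedHalfPlaneMap s) U
        (Metric.ball (stretchedHalfPlaneMap s 0) r)) => ENNReal.ofReal r) (s / 2)
      ⟨by positivity, unitDisk ∩ stretchedHalfPlaneMap s ⁻¹'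
        Metric.ball (stretchedHalfPlaneMap s 0) (s / 2),
        hcont.isOpen_inter_preimage Metric.isOpen_ball Metric.isOpen_ball, inter_subset_left,
        ⟨Metric.mem_ball_self one_pos, Metric.mem_ball_self (by positivity)⟩,
        fun z hz => hz.2, hbij.injOn.mono inter_subset_left, fun w hw => ?_⟩
    obtain ⟨z, hz, rfl⟩ := hbij.surjOn (a := w) <| by
      rw [stretchedHalfPlaneMap_zero, mem_ball_zero_iff] at hw
      exact (abs_lt.mp ((Complex.abs_im_le_norm w).trans_lt hw)).1
    exact ⟨z, ⟨hz, hw⟩, rfl⟩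

theorem normalizedPart_const_mul_halfPlaneMap {b : ℂ} (hb : b ≠ 0) (c : ℂ) :
    normalizedPart (fun z => b * halfPlaneMap c z) = halfPlaneMap c := by
  have h1 : deriv (fun z => b * halfPlaneMap c z) 0 = b := by
    have := ((hasDerivAt_halfPlaneMap (c := c) (z := 0) (by simp)).const_mul b).deriv
    simpa using this
  funext z
  rw [normalizedPart, h1, mul_div_cancel_left₀ _ hb]

theorem memHarmonicFamily_stretchedHalfPlaneMap {α : ℝ≥0∞} (hα : 1 ≤ α) {Q s : ℝ} (hs : 0 < s)
    (hsQ : |1 - s| / (1 + s) ≤ (Q - 1) / (Q + 1)) :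
    MemHarmonicFamily α Q (stretchedHalfPlaneMap s)
      (fun z => ((1 + s) / 2 : ℂ) * halfPlaneMap (-Complex.I) z)
      (fun z => ((1 - s) / 2 : ℂ) * halfPlaneMap (-Complex.I) z) := by
  have hb : ((1 + s) / 2 : ℂ) ≠ 0 := by
    norm_cast
    positivity
  have hd : ∀ b : ℂ, ∀ z ∈ unitDisk, deriv (fun z => b * halfPlaneMap (-Complex.I) z) z =
      b * (1 / (1 - -Complex.I * z) ^ 2) := fun b z hz =>
    ((hasDerivAt_halfPlaneMap (one_sub_mul_ne_zero norm_neg_I hz)).const_mul b).deriv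
  have h0D : (0 : ℂ) ∈ unitDisk := Metric.mem_ball_self one_pos
  refine ⟨differentiableOn_halfPlaneMap_neg_I.const_mul _,
    differentiableOn_halfPlaneMap_neg_I.const_mul _, by simp [halfPlaneMap],
    by simp [halfPlaneMap], fun z _ => rfl,
    fun z hz => ⟨unitDisk, Metric.isOpen_ball.mem_nhds hz, (stretchedHalfPlaneMap_bijOn hs).injOn⟩,
    ?_, ?_, fun z hz => ?_⟩
  · rw [hd _ _ h0D, hd _ _ h0D, ← Complex.ofReal_one, ← Complex.ofReal_ofNat, ← Complex.ofReal_add,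
      ← Complex.ofReal_sub, ← Complex.ofReal_div, ← Complex.ofReal_div]
    simp only [mul_zero, sub_zero, Complex.ofReal_one, one_pow, div_one, mul_one,
      Complex.conj_ofReal]
    push_cast
    ring
  · rw [normalizedPart_const_mul_halfPlaneMap hb]
    exact halfPlaneMap_mem_universalLIF hα norm_neg_I
  · rw [hd _ _ hz, hd _ _ hz, mul_div_mul_right _ _
      (one_div_ne_zero (pow_ne_zero 2 (one_sub_mul_ne_zero norm_neg_I hz))),
      div_div_div_cancel_right₀ two_ne_zero]
    convert hsQ using 1
    rw [norm_div]
    norm_cast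
    rw [Real.norm_eq_abs, Real.norm_of_nonneg (by positivity)]

theorem univalentRadius_halfPlaneMap_neg_I :
    univalentRadius (halfPlaneMap (-Complex.I)) 0 = ENNReal.ofReal (1 / 2) := by
  have : stretchedHalfPlaneMap 1 = halfPlaneMap (-Complex.I) := by
    funext z
    simp [stretchedHalfPlaneMap]
  rw [← this, univalentRadius_stretchedHalfPlaneMap one_pos]

/-- Stretching the half-plane by the factor `s` perpendicularly to its boundary multiplies the radius
of the univalent disk at the origin by `s`; the values `s = Q` and `s = 1 / Q` are admissible. -/
theorem exists_memHarmonicFamily_univalentRadius {α : ℝ≥0∞} (hα : 1 ≤ α) {Q s : ℝ} (hs : 0 < s)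
    (hsQ : |1 - s| / (1 + s) ≤ (Q - 1) / (Q + 1)) :
    ∃ f h g : ℂ → ℂ, MemHarmonicFamily α Q f h g ∧
      univalentRadius f 0 = ENNReal.ofReal s * univalentRadius (normalizedPart h) 0 := by
  refine ⟨_, _, _, memHarmonicFamily_stretchedHalfPlaneMap hα hs hsQ, ?_⟩
  have hb : ((1 + s) / 2 : ℂ) ≠ 0 := by
    norm_cast
    positivity
  rw [normalizedPart_const_mul_halfPlaneMap hb, univalentRadius_halfPlaneMap_neg_I,
    univalentRadius_stretchedHalfPlaneMap hs, ← ENNReal.ofReal_mul hs.le, mul_one_div]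

/-! ### The two-sided estimate and its sharpness -/

theorem mainTheorem2 (α : ℝ≥0∞) (Q : ℝ) (hQ : 1 ≤ Q) :
    (∀ f h g : ℂ → ℂ, MemHarmonicFamily α Q f h g → ∀ z ∈ unitDisk,
      univalentRadius (normalizedPart h) z / ENNReal.ofReal Q ≤ univalentRadius f z ∧
      univalentRadius f z ≤ ENNReal.ofReal Q * univalentRadius (normalizedPart h) z) ∧
    (1 ≤ α →
      (∃ f h g : ℂ → ℂ, MemHarmonicFamily α Q f h g ∧
        univalentRadius f 0 = univalentRadius (normalizedPart h) 0 / ENNReal.ofReal Q) ∧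
      (∃ f h g : ℂ → ℂ, MemHarmonicFamily α Q f h g ∧
        univalentRadius f 0 = ENNReal.ofReal Q * univalentRadius (normalizedPart h) 0)) := by
  have hQ0 : 0 < Q := by linarith
  refine ⟨fun f h g hf z _ => univalentRadius_bounds hQ hf z, fun hα => ⟨?_, ?_⟩⟩
  · have hs : |1 - Q⁻¹| / (1 + Q⁻¹) ≤ (Q - 1) / (Q + 1) := by
      rw [abs_of_nonneg (sub_nonneg.mpr (inv_le_one_of_one_le₀ hQ))]
      apply le_of_eq
      field_simp
    obtain ⟨f, h, g, hf, he⟩ := exists_memHarmonicFamily_univalentRadius hα (inv_pos.mpr hQ0) hs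
    refine ⟨f, h, g, hf, ?_⟩
    rw [he, ENNReal.ofReal_inv_of_pos hQ0, mul_comm, ENNReal.div_eq_inv_mul, mul_comm]
  · refine exists_memHarmonicFamily_univalentRadius hα hQ0 ?_
    rw [abs_sub_comm, abs_of_nonneg (sub_nonneg.mpr hQ), add_comm]
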